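/- Let $\mathcal M$ be a regular matroid on a finite ground set $E$, represented over $\mathbb R$ by a totally unimodular matrix $M$ with columns indexed by $E$. An *arc* is a vector of $\mathbb R^E$ with one entry equal to $\pm1$ and all other entries $0$; each edge $e\in E$ carries two opposite arcs. A *fourientation* is a set $F$ of arcs; $-F$ denotes the set of the opposites of the arcs of $F$, and $F^c$ the complement of $F$ in the set of all arcs. An edge is *bioriented* in $F$ if both of its arcs are in $F$, and *one-way oriented* if exactly one is. An *orientation* is a fourientation in which every edge is one-way oriented. A *signed circuit* (resp. *signed cocircuit*) is a $\{0,\pm1\}$-vector in $\ker M$ (resp. in $\operatorname{im} M^{T}$) whose support is a circuit (resp. a cocircuit) of $\mathcal M$; it is regarded as the set of arcs given by its nonzero entries. A *potential circuit* of a fourientation $F$ is a signed circuit $C\subseteq F$; a *potential cocircuit* of $F$ is a signed cocircuit $C^*\subseteq -F^c$. Replacing a signed circuit (resp. signed cocircuit) $C$ contained in an orientation by $-C$ is a *circuit* (resp. *cocircuit*) *reversal*; the classes of the equivalence relation on orientations generated by all circuit and cocircuit reversals are the *circuit-cocircuit reversal classes*, and $[O]$ is the class of $O$. An *external atlas* $\mathcal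 A$ assigns to every basis $B$ of $\mathcal M$ a fourientation $\overrightarrow{B}$ in which the edges of $B$ are bioriented and the edges of $E\setminus B$ are one-way oriented. An *internal atlas* $\mathcal A^*$ assigns to every basis $B$ a fourientation $\overrightarrow{B^*}$ in which the edges of $E\setminus B$ are bioriented and the edges of $B$ are one-way oriented. The atlas $\mathcal A$ is *dissecting* (resp. *triangulating*) if for any two distinct bases $B_1,B_2$ the fourientation $\overrightarrow{B_1}\cap(-\overrightarrow{B_2})$ has a potential cocircuit (resp. has no potential circuit). The atlas $\mathcal A^*$ is *dissecting* (resp. *triangulating*) if for any two distinct bases $B_1,B_2$ the fourientation $\bigl(\overrightarrow{B_1^*}\cap(-\overrightarrow{B_2^*})\bigr)^c$ has a potential circuit (resp. has no potential cocircuit). **Theorem.** Let $\mathcal A$ be an external atlas and $\mathcal A^*$ an internal atlas of $\mathcal M$. Suppose that both are dissecting and that at least one of them is triangulating. Then the map $$B\longmapsto\bigl[\overrightarrow{B}\cap\overrightarrow{B^*}\bigr]$$ from the set of bases of $\mathcal M$ to the set of circuit-cocircuit reversal classes of $\mathcal M$ is a bijection. -/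

import Mathlib

namespace RegularMatroid

variable {E m : Type*}

/-- The matrix `A`, with columns indexed by the type `E`, represents the matroid `M` over `ℝ`:
the ground set of `M` is all of `E`, and a set of edges is independent in `M` if and only if the
corresponding family of columns of `A` is linearly independent. -/
structure Represents (A : Matrix m E ℝ) (M : Matroid E) : Prop where
  ground_eq : M.E = Set.univ
  indep_iff : ∀ I : Set E, M.Indep I ↔ LinearIndepOn ℝ A.col I

/-- The type of bases of a matroid. -/
abbrev Basis (M : Matroid E) : Type _ := {B : Set E // M.IsBase B}

/-- An arc is an edge together with a sign: `(e, 1)` and `(e, -1)` stand for the two vectors of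
`ℝ^E` whose `e`-th entry is `1`, respectively `-1`, and whose other entries vanish. -/
abbrev Arc (E : Type*) : Type _ := E × ℤˣ

/-- A fourientation is an arbitrary set of arcs. -/
abbrev Fourientation (E : Type*) : Type _ := Set (Arc E)

/-- The fourientation `-F`, obtained by reversing all the arcs of `F`. -/
def reverse (F : Fourientation E) : Fourientation E := {a | (a.1, -a.2) ∈ F}

/-- A `{0, 1, -1}`-vector viewed as a set of arcs: an edge contributes the arc whose sign is
the entry of the vector at this edge, and nothing when that entry is `0`. -/
def arcsOf (v : E → ℝ) : Fourientation E := {a | v a.1 = ((a.2 : ℤ) : ℝ)}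

/-- A signed circuit: a `{0, 1, -1}`-vector in the kernel of `A` whose support is a circuit of
`M`, viewed as a set of arcs. -/
def IsSignedCircuit [Fintype E] (A : Matrix m E ℝ) (M : Matroid E) (C : Fourientation E) : Prop :=
  ∃ v : E → ℝ, (∀ e, v e = 0 ∨ v e = 1 ∨ v e = -1) ∧ v ∈ LinearMap.ker A.mulVecLin ∧
    M.IsCircuit (Function.support v) ∧ C = arcsOf v

/-- A signed cocircuit: a `{0, 1, -1}`-vector in the image of the transpose of `A` whose support
is a cocircuit of `M`, viewed as a set of arcs. -/
def IsSignedCocircuit [Fintype m] (A : Matrix m E ℝ) (M : Matroid E) (C : Fourientation E) : Prop :=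
  ∃ v : E → ℝ, (∀ e, v e = 0 ∨ v e = 1 ∨ v e = -1) ∧
    v ∈ LinearMap.range A.transpose.mulVecLin ∧
    M.IsCocircuit (Function.support v) ∧ C = arcsOf v

/-- A potential circuit of `F` is a signed circuit contained in `F`. -/
def IsPotentialCircuit [Fintype E] (A : Matrix m E ℝ) (M : Matroid E)
    (F C : Fourientation E) : Prop :=
  IsSignedCircuit A M C ∧ C ⊆ F

/-- A potential cocircuit of `F` is a signed cocircuit contained in `-Fᶜ`. -/
def IsPotentialCocircuit [Fintype m] (A : Matrix m E ℝ) (M : Matroid E)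
    (F C : Fourientation E) : Prop :=
  IsSignedCocircuit A M C ∧ C ⊆ reverse Fᶜ

/-- The edge `e` is bioriented in `F`: both of its arcs lie in `F`. -/
def IsBioriented (F : Fourientation E) (e : E) : Prop := ∀ s : ℤˣ, (e, s) ∈ F

/-- The edge `e` is one-way oriented in `F`: exactly one of its two arcs lies in `F`. -/
def IsOneWay (F : Fourientation E) (e : E) : Prop := ∃! s : ℤˣ, (e, s) ∈ F

/-- An orientation is a set of arcs in which each edge appears exactly once. -/
structure EdgeOrientation (E : Type*) where
  arcs : Fourientation E
  isOneWay : ∀ e, IsOneWay arcs e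

/-- `O'` is obtained from `O` by one circuit reversal or one cocircuit reversal: some signed
circuit or signed cocircuit `C ⊆ O` is replaced by `-C`. -/
def IsReversal [Fintype E] [Fintype m] (A : Matrix m E ℝ) (M : Matroid E)
    (O O' : EdgeOrientation E) : Prop :=
  ∃ C : Fourientation E, (IsSignedCircuit A M C ∨ IsSignedCocircuit A M C) ∧ C ⊆ O.arcs ∧
    O'.arcs = (O.arcs \ C) ∪ reverse C

/-- The equivalence relation on orientations generated by circuit and cocircuit reversals. -/
def reversalSetoid [Fintype E] [Fintype m] (A : Matrix m E ℝ) (M : Matroid E) :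
    Setoid (EdgeOrientation E) :=
  Relation.EqvGen.setoid (IsReversal A M)

/-- The circuit-cocircuit reversal classes. -/
abbrev ReversalClass [Fintype E] [Fintype m] (A : Matrix m E ℝ) (M : Matroid E) : Type _ :=
  Quotient (reversalSetoid A M)

/-- An external atlas: a choice, for each basis `B`, of one externally oriented basis `orient B`,
a fourientation in which the edges of `B` are bioriented and the other edges are one-way
oriented. -/
structure ExternalAtlas (M : Matroid E) where
  orient : Basis M → Fourientation E
  internal : ∀ (B : Basis M) (e : E), e ∈ B.1 → IsBioriented (orient B) e
  external : ∀ (B : Basis M) (e : E), e ∉ B.1 → IsOneWay (orient B) e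

/-- An internal atlas: a choice, for each basis `B`, of one internally oriented basis `orient B`,
a fourientation in which the edges outside `B` are bioriented and the edges of `B` are one-way
oriented. -/
structure InternalAtlas (M : Matroid E) where
  orient : Basis M → Fourientation E
  internal : ∀ (B : Basis M) (e : E), e ∈ B.1 → IsOneWay (orient B) e
  external : ∀ (B : Basis M) (e : E), e ∉ B.1 → IsBioriented (orient B) e

namespace ExternalAtlas

/-- For distinct bases, `B₁ ∩ (-B₂)` (as oriented in the atlas) has a potential cocircuit. -/
def IsDissecting [Fintype m] {M : Matroid E} (𝒜 : ExternalAtlas M) (A : Matrix m E ℝ) : Prop :=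
  ∀ B₁ B₂ : Basis M, B₁ ≠ B₂ →
    ∃ C, IsPotentialCocircuit A M (𝒜.orient B₁ ∩ reverse (𝒜.orient B₂)) C

/-- For distinct bases, `B₁ ∩ (-B₂)` (as oriented in the atlas) has no potential circuit. -/
def IsTriangulating [Fintype E] {M : Matroid E} (𝒜 : ExternalAtlas M)
    (A : Matrix m E ℝ) : Prop :=
  ∀ B₁ B₂ : Basis M, B₁ ≠ B₂ →
    ¬ ∃ C, IsPotentialCircuit A M (𝒜.orient B₁ ∩ reverse (𝒜.orient B₂)) C

end ExternalAtlas

namespace InternalAtlas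

/-- For distinct bases, `(B₁ ∩ (-B₂))ᶜ` (as oriented in the atlas) has a potential circuit. -/
def IsDissecting [Fintype E] {M : Matroid E} (𝒜 : InternalAtlas M) (A : Matrix m E ℝ) : Prop :=
  ∀ B₁ B₂ : Basis M, B₁ ≠ B₂ →
    ∃ C, IsPotentialCircuit A M (𝒜.orient B₁ ∩ reverse (𝒜.orient B₂))ᶜ C

/-- For distinct bases, `(B₁ ∩ (-B₂))ᶜ` (as oriented in the atlas) has no potential cocircuit. -/
def IsTriangulating [Fintype m] {M : Matroid E} (𝒜 : InternalAtlas M)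
    (A : Matrix m E ℝ) : Prop :=
  ∀ B₁ B₂ : Basis M, B₁ ≠ B₂ →
    ¬ ∃ C, IsPotentialCocircuit A M (𝒜.orient B₁ ∩ reverse (𝒜.orient B₂))ᶜ C

end InternalAtlas

/-- The orientation attached to the basis `B` by a pair of atlases: the intersection of the
externally oriented basis and the internally oriented basis of `B`. -/
def orientationOfBasis {M : Matroid E} (𝒜 : ExternalAtlas M) (𝒜' : InternalAtlas M)
    (B : Basis M) : EdgeOrientation E where
  arcs := 𝒜.orient B ∩ 𝒜'.orient B
  isOneWay := by
    intro e
    by_cases he : e ∈ B.1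
    · obtain ⟨s, hs, hu⟩ := 𝒜'.internal B e he
      exact ⟨s, ⟨𝒜.internal B e he s, hs⟩, fun t ht => hu t ht.2⟩
    · obtain ⟨s, hs, hu⟩ := 𝒜.external B e he
      exact ⟨s, ⟨hs, 𝒜'.external B e he s⟩, fun t ht => hu t ht.1⟩

end RegularMatroid

/-!
The kernel and the row space of a totally unimodular matrix are regular subspaces: every
nonzero `{0, 1, -1}`-vector in them agrees with an elementary `{0, 1, -1}`-vector on the support of
the latter. Hence two orientations are related by reversals if and only if the difference of their
indicator vectors is `u + w` with `u` in the kernel and `w` in the row space, both integral;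
orthogonality forces such `u` and `w` to have disjoint supports.

Injectivity: let `u + w` be the difference for the orientations of two distinct bases, and say that
`𝒜` is triangulating. A signed circuit conforming to `u` would be a forbidden potential circuit, so
`u = 0`. As `𝒜'` is dissecting, it provides a signed circuit whose scalar product with `w` has only
nonpositive terms. This circuit is orthogonal to `w`, hence disjoint from it, and this makes it a
forbidden potential circuit as well. The other case is dual.

Surjectivity: the reversal classes embed into the cokernel of the Gram matrix `N * Nᵀ`, where the
rows of `N` are a maximal independent set of rows of `A`. Its order is `det (N * Nᵀ)`, which by the
Cauchy–Binet formula is at most the number of bases, so an injection must be a bijection.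
-/

namespace RegularMatroid

open Matrix Function

variable {E m : Type*}

section Elementary

/-- The vector `v` conforms to `x`: on the support of `v`, both vectors have the same signs. -/
def Conforms (v x : E → ℝ) : Prop := ∀ e, v e ≠ 0 → 0 < v e * x e

/-- An elementary vector of `S`, in the sense of Rockafellar: a nonzero vector of minimal support.
For the kernel and the row space of a representation these carry the circuits and the cocircuits. -/
def IsElementary (S : Submodule ℝ (E → ℝ)) (v : E → ℝ) : Prop :=
  MinimalFor (fun z => z ∈ S ∧ z ≠ 0) support v

variable {S : Submodule ℝ (E → ℝ)} {v w x y z : E → ℝ} {e : E}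

theorem Conforms.trans (hvx : Conforms v x) (hxy : Conforms x y) : Conforms v y := by
  intro e he
  have hve := hvx e he
  have hxe := hxy e (right_ne_zero_of_mul hve.ne')
  refine pos_of_mul_pos_left (b := x e * x e) ?_ (mul_self_nonneg _)
  linarith [mul_pos hve hxe]

theorem IsElementary.mem (hv : IsElementary S v) : v ∈ S := hv.prop.1

theorem IsElementary.ne_zero (hv : IsElementary S v) : v ≠ 0 := hv.prop.2

theorem IsElementary.smul (hv : IsElementary S v) {c : ℝ} (hc : c ≠ 0) :
    IsElementary S (c • v) := by
  refine ⟨⟨S.smul_mem c hv.mem, smul_ne_zero hc hv.ne_zero⟩, fun z hz hzv => ?_⟩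
  rw [support_const_smul_of_ne_zero c v hc] at hzv ⊢
  exact hv.le_of_le hz hzv

theorem IsElementary.eq_smul (hv : IsElementary S v) (hz : z ∈ S) (hzv : support z ⊆ support v)
    (he : v e = 1) : z = z e • v := by
  by_contra hne
  have hsub : support (z - z e • v) ⊆ support v := fun f hf hvf =>
    hf (by simp [notMem_support.1 fun hzf => hzv hzf hvf, hvf])
  have hmem : e ∈ support (z - z e • v) :=
    hv.le_of_le ⟨S.sub_mem hz (S.smul_mem _ hv.mem), sub_ne_zero.2 hne⟩ hsub (by simp [he])
  simp [he] at hmem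

/-- Move from `y` in the direction `-z` until the first entry vanishes. -/
theorem exists_conforms_sub_smul [Finite E] (hzy : support z ⊆ support y)
    (hpos : ∃ f, 0 < z f * y f) :
    ∃ t : ℝ, 0 < t ∧ Conforms (y - t • z) y ∧ support (y - t • z) ⊂ support y := by
  obtain ⟨f, hf, hmin⟩ :=
    Set.exists_min_image {f | 0 < z f * y f} (fun f => y f / z f) (Set.toFinite _) hpos
  have hzf : z f ≠ 0 := left_ne_zero_of_mul (ne_of_gt hf)
  have hsub : support (y - (y f / z f) • z) ⊆ support y := fun g hg hyg =>
    hg (by simp [notMem_support.1 fun hzg => hzy hzg hyg, hyg])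
  have ht : 0 < y f / z f := div_pos_iff.2 (mul_pos_iff.1 (mul_comm (z f) _ ▸ hf))
  refine ⟨y f / z f, ht, fun g hg => lt_of_le_of_ne ?_ (mul_ne_zero hg (hsub hg)).symm,
    hsub.ssubset_of_mem_notMem (right_ne_zero_of_mul (ne_of_gt hf)) (by simp [hzf])⟩
  simp only [Pi.sub_apply, Pi.smul_apply, smul_eq_mul]
  by_cases hzyg : 0 < z g * y g
  · have hzg : z g ≠ 0 := left_ne_zero_of_mul hzyg.ne'
    calc 0 ≤ (y g / z g - y f / z f) * (z g * y g) :=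
          mul_nonneg (sub_nonneg.2 (hmin g hzyg)) hzyg.le
      _ = (y g - y f / z f * z g) * y g := by field_simp
  · nlinarith [mul_self_nonneg (y g)]

/-- Take a conforming vector of minimal support among those not vanishing at `e`: a vector of `S`
inside its support with the wrong sign at some entry could be used to shrink that support. -/
theorem exists_isElementary_conforms [Finite E] (hx : x ∈ S) (he : x e ≠ 0) :
    ∃ v, IsElementary S v ∧ v e ≠ 0 ∧ Conforms v x := by
  obtain ⟨y, ⟨hyS, hye, hyx⟩, hmin⟩ := exists_minimalFor_of_wellFoundedLT
    (fun z => z ∈ S ∧ z e ≠ 0 ∧ Conforms z x) support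
    ⟨x, hx, he, fun _ hf => mul_self_pos.2 hf⟩
  have hkey : ∀ z ∈ S, support z ⊆ support y → (∃ f, 0 < z f * y f) → 0 < z e * y e := by
    intro z hz hzy hpos
    obtain ⟨t, ht, hconf, hlt⟩ := exists_conforms_sub_smul hzy hpos
    have hzero : (y - t • z) e = 0 := by
      by_contra hne
      exact hlt.not_subset (hmin ⟨S.sub_mem hyS (S.smul_mem t hz), hne, hconf.trans hyx⟩ hlt.le)
    have hyz : y e = t * z e := sub_eq_zero.1 hzero
    have hze : z e ≠ 0 := right_ne_zero_of_mul (hyz ▸ hye)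
    calc 0 < t * (z e * z e) := mul_pos ht (mul_self_pos.2 hze)
      _ = z e * y e := by rw [hyz]; ring
  have hall : ∀ z ∈ S, support z ⊆ support y → (∃ f, 0 < z f * y f) →
      support y ⊆ support z := by
    intro z hz hzy hpos
    have hze := hkey z hz hzy hpos
    have hnonneg : ∀ f, 0 ≤ z f * y f := by
      by_contra! ⟨f, hf⟩
      have hneg := hkey (-z) (S.neg_mem hz) (by rwa [support_neg]) ⟨f, by simpa using hf⟩
      rw [Pi.neg_apply, neg_mul, neg_pos] at hneg
      exact hneg.asymm hze
    exact hmin ⟨hz, left_ne_zero_of_mul hze.ne', Conforms.trans (fun f hf =>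
      lt_of_le_of_ne (hnonneg f) (mul_ne_zero hf (hzy hf)).symm) hyx⟩ hzy
  refine ⟨y, ⟨⟨hyS, fun h => hye (congrFun h e)⟩, fun z ⟨hz, hz0⟩ hzy => ?_⟩, hye, hyx⟩
  obtain ⟨f, hf⟩ := Function.ne_iff.1 hz0
  rcases lt_or_gt_of_ne (mul_ne_zero hf (hzy hf)) with hneg | hpos
  · exact (hall (-z) (S.neg_mem hz) ((support_neg z).trans_le hzy)
      ⟨f, by simpa using hneg⟩).trans_eq (support_neg z)
  · exact hall z hz hzy ⟨f, hpos⟩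

end Elementary

section Regular

/-- A `{0, 1, -1}`-vector. -/
def IsSignVector (v : E → ℝ) : Prop := ∀ e, v e = 0 ∨ v e = 1 ∨ v e = -1

/-- A regular subspace, in the sense of Tutte: an elementary vector with some entry equal to `1`
has all its entries in `{0, 1, -1}`. -/
def IsRegular (S : Submodule ℝ (E → ℝ)) : Prop :=
  ∀ v, IsElementary S v → ∀ e, v e = 1 → IsSignVector v

variable {S : Submodule ℝ (E → ℝ)} {v x : E → ℝ}

theorem IsSignVector.neg (hv : IsSignVector v) : IsSignVector (-v) := by
  intro e
  rcases hv e with h | h | h <;> simp [h]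

theorem IsSignVector.eq_of_mul_pos (hv : IsSignVector v) (hx : IsSignVector x) {e : E}
    (h : 0 < v e * x e) : v e = x e := by
  rcases hv e with hv | hv | hv <;> rcases hx e with hx | hx | hx <;>
    rw [hv, hx] at h ⊢ <;> norm_num at h

theorem IsRegular.exists_isElementary [Finite E] (hS : IsRegular S) (hx : x ∈ S) (hx0 : x ≠ 0)
    (hxs : IsSignVector x) :
    ∃ v, IsElementary S v ∧ IsSignVector v ∧ ∀ e, v e ≠ 0 → v e = x e := by
  obtain ⟨e, he⟩ := Function.ne_iff.1 hx0
  obtain ⟨v, hv, hve, hvx⟩ := exists_isElementary_conforms hx he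
  have hsign : IsSignVector (|v e|⁻¹ • v) := by
    have h := hS _ (hv.smul (inv_ne_zero hve)) e (by simp [hve])
    rcases abs_choice (v e) with habs | habs
    · rwa [habs]
    · rw [habs, inv_neg, neg_smul]
      exact h.neg
  have hpos : 0 < |v e|⁻¹ := inv_pos.2 (abs_pos.2 hve)
  refine ⟨_, hv.smul hpos.ne', hsign, fun f hf => hsign.eq_of_mul_pos hxs ?_⟩
  rw [Pi.smul_apply, smul_eq_mul, mul_assoc]
  exact mul_pos hpos (hvx f (right_ne_zero_of_mul hf))

theorem IsRegular.map_funLeft {E' : Type*} [Finite E] (hS : IsRegular S) (i : E' → E) :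
    IsRegular (S.map (LinearMap.funLeft ℝ ℝ i)) := by
  intro v hv e he
  obtain ⟨x, hx, rfl⟩ := hv.mem
  obtain ⟨z, hz, hze, hzx⟩ := exists_isElementary_conforms (e := i e) hx
    (by rw [LinearMap.funLeft_apply] at he; simp [he])
  have hzv : LinearMap.funLeft ℝ ℝ i z = z (i e) • LinearMap.funLeft ℝ ℝ i x :=
    hv.eq_smul ⟨z, hz.mem, rfl⟩ (fun f hf => right_ne_zero_of_mul (hzx (i f) hf).ne') he
  have hsign : IsSignVector ((z (i e))⁻¹ • z) :=
    hS _ (hz.smul (inv_ne_zero hze)) (i e) (by simp [hze])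
  intro f
  have hf : z (i f) = z (i e) * x (i f) := congrFun hzv f
  simpa [hf, hze] using hsign (i f)

end Regular

section TotallyUnimodular

theorem exists_submatrix_det_ne_zero {n : Type*} [Finite m] [Fintype n] [DecidableEq n]
    {Q : Matrix m n ℝ} (hQ : LinearIndependent ℝ Q.col) :
    ∃ r : n → m, (Q.submatrix r id).det ≠ 0 := by
  obtain ⟨κ, a, ha, hspan, hli⟩ := exists_linearIndependent' ℝ Q.row
  have := Fintype.ofFinite m
  have := Fintype.ofInjective a ha
  have hcard : Fintype.card n = Fintype.card κ := by
    rw [← finrank_span_eq_card hli, hspan, ← rank_eq_finrank_span_row, ← rank_transpose]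
    exact (LinearIndependent.rank_matrix (M := Qᵀ) hQ).symm
  let σ : n ≃ κ := Fintype.equivOfCardEq hcard
  exact ⟨a ∘ σ, ((isUnit_iff_isUnit_det _).1
    (linearIndependent_rows_iff_isUnit.1 (hli.comp σ σ.injective))).ne_zero⟩

/-- By Cramer's rule, each entry of `x` is a quotient of two minors of `A`. -/
theorem isSignVector_of_mulVec_submatrix_eq_col {n : Type*} [Finite m] [Fintype n]
    {A : Matrix m E ℝ} (hA : A.IsTotallyUnimodular) {g : n → E}
    (hg : LinearIndependent ℝ (A.submatrix id g).col) {x : n → ℝ} {e : E}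
    (hx : A.submatrix id g *ᵥ x = A.col e) : IsSignVector x := by
  classical
  obtain ⟨r, hr⟩ := exists_submatrix_det_ne_zero hg
  rw [submatrix_submatrix, id_comp, comp_id] at hr
  rw [isTotallyUnimodular_iff_fintype] at hA
  intro j
  have hcol : A.submatrix r g *ᵥ x = fun i => A (r i) e := funext fun i => congrFun hx (r i)
  have hupdate : (A.submatrix r g).updateCol j (fun i => A (r i) e) =
      A.submatrix r (update g j e) := by
    ext i k
    obtain rfl | hk := eq_or_ne k j <;> simp [*]
  have hcramer : (A.submatrix r g).det * x j = (A.submatrix r (update g j e)).det := by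
    rw [← hupdate, ← cramer_apply, ← hcol, cramer_eq_adjugate_mulVec, mulVec_mulVec,
      adjugate_mul, smul_mulVec, one_mulVec, Pi.smul_apply, smul_eq_mul]
  obtain ⟨a, ha⟩ := hA n r g
  obtain ⟨b, hb⟩ := hA n r (update g j e)
  have hquot : x j = ((a * b : SignType) : ℝ) := by
    have haa : a * a = 1 := by
      cases a with
      | zero => exact absurd ha.symm hr
      | pos | neg => rfl
    rw [SignType.coe_mul, hb, ← hcramer, ← ha, ← mul_assoc, ← SignType.coe_mul, haa,
      SignType.coe_one, one_mul]
  rw [hquot]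
  cases a * b <;> simp

theorem linearIndepOn_col_iff [Fintype E] {A : Matrix m E ℝ} {I : Set E} :
    LinearIndepOn ℝ A.col I ↔ ∀ c ∈ LinearMap.ker A.mulVecLin, support c ⊆ I → c = 0 := by
  have hcomb : ∀ c : E → ℝ, Finsupp.linearCombination ℝ A.col
      ((Finsupp.linearEquivFunOnFinite ℝ ℝ E).symm c) = A *ᵥ c := by
    intro c
    rw [Finsupp.linearCombination_eq_fintype_linearCombination_apply,
      Fintype.linearCombination_apply, mulVec_eq_sum]
    simp [col_def]
  rw [linearIndepOn_iff, (Finsupp.linearEquivFunOnFinite ℝ ℝ E).symm.surjective.forall]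
  refine forall_congr' fun c => ?_
  rw [hcomb, Finsupp.mem_supported, LinearMap.mem_ker, mulVecLin_apply, LinearEquiv.map_eq_zero_iff,
    ← Finsupp.fun_support_eq, imp.swap]
  rfl

theorem isRegular_ker [Fintype E] [Finite m] {A : Matrix m E ℝ} (hA : A.IsTotallyUnimodular) :
    IsRegular (LinearMap.ker A.mulVecLin) := by
  classical
  intro v hv e he
  let g : {f // v f ≠ 0 ∧ f ≠ e} → E := Subtype.val
  have hg : LinearIndependent ℝ (A.submatrix id g).col := by
    refine linearIndepOn_col_iff.2 fun z hz hzp => ?_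
    rw [hv.eq_smul hz (fun f hf => (hzp hf).1) he, notMem_support.1 fun hze => (hzp hze).2 rfl,
      zero_smul]
  have hx : A.submatrix id g *ᵥ (-v ∘ g) = A.col e := by
    ext i
    have hker : ∑ f, A i f * v f = 0 := congrFun (LinearMap.mem_ker.1 hv.mem) i
    have hcompl : ∑ f : {f // ¬(v f ≠ 0 ∧ f ≠ e)}, A i f * v f = A i e * v e := by
      let e' : {f // ¬(v f ≠ 0 ∧ f ≠ e)} := ⟨e, fun h => h.2 rfl⟩
      refine Fintype.sum_eq_single e' fun f hf => ?_
      have hvf : v f = 0 := by_contra fun h => f.2 ⟨h, fun hfe => hf (Subtype.ext hfe)⟩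
      rw [hvf, mul_zero]
    rw [← Fintype.sum_subtype_add_sum_subtype (fun f => v f ≠ 0 ∧ f ≠ e),
      hcompl, he, mul_one] at hker
    rw [mulVec_neg]
    exact (neg_eq_of_add_eq_zero_right hker)
  have hsign := isSignVector_of_mulVec_submatrix_eq_col hA hg hx
  intro f
  by_cases hf : v f ≠ 0 ∧ f ≠ e
  · simpa using IsSignVector.neg hsign ⟨f, hf⟩
  · by_cases h0 : v f = 0
    · exact Or.inl h0
    · obtain rfl : f = e := by_contra fun hne => hf ⟨h0, hne⟩
      exact Or.inr (Or.inl he)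

theorem isRegular_range_transpose [Finite E] [Fintype m] {A : Matrix m E ℝ}
    (hA : A.IsTotallyUnimodular) :
    IsRegular (LinearMap.range Aᵀ.mulVecLin) := by
  classical
  have := Fintype.ofFinite E
  have hrange : LinearMap.range Aᵀ.mulVecLin =
      (LinearMap.ker (fromCols Aᵀ (1 : Matrix E E ℝ)).mulVecLin).map
        (LinearMap.funLeft ℝ ℝ Sum.inr) := by
    ext w
    constructor
    · rintro ⟨y, rfl⟩
      exact ⟨Sum.elim (-y) (Aᵀ *ᵥ y), by simp [mulVec_neg], rfl⟩
    · rintro ⟨x, hx, rfl⟩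
      refine ⟨-(x ∘ Sum.inl), ?_⟩
      rw [SetLike.mem_coe, LinearMap.mem_ker, mulVecLin_apply, fromCols_mulVec, one_mulVec] at hx
      rw [mulVecLin_apply, mulVec_neg]
      exact neg_eq_of_add_eq_zero_right hx
  rw [hrange]
  exact (isRegular_ker ((fromCols_one_isTotallyUnimodular_iff _).2 hA.transpose)).map_funLeft _

end TotallyUnimodular

section Circuits

variable {S : Submodule ℝ (E → ℝ)} {A : Matrix m E ℝ} {M : Matroid E} {v w : E → ℝ} {X : Set E}

theorem isElementary_iff_minimal (hv : v ∈ S) :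
    IsElementary S v ↔ Minimal (fun X => ∃ z ∈ S, z ≠ 0 ∧ support z ⊆ X) (support v) := by
  constructor
  · exact fun h => ⟨⟨v, hv, h.ne_zero, subset_rfl⟩, fun Y ⟨z, hz, hz0, hzY⟩ hYv =>
      (h.le_of_le ⟨hz, hz0⟩ (hzY.trans hYv)).trans hzY⟩
  · intro h
    obtain ⟨z, -, hz0, hzv⟩ := h.prop
    refine ⟨⟨hv, ?_⟩, fun y hy hyv => h.le_of_le ⟨y, hy.1, hy.2, subset_rfl⟩ hyv⟩
    rintro rfl
    exact hz0 (support_eq_empty_iff.1 (Set.subset_empty_iff.1 (hzv.trans_eq support_zero)))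

theorem mem_range_transpose_iff [Fintype m] :
    w ∈ LinearMap.range Aᵀ.mulVecLin ↔ ∃ φ : Module.Dual ℝ (m → ℝ), ∀ e, φ (A.col e) = w e := by
  classical
  rw [LinearMap.mem_range, (dotProductEquiv ℝ m).surjective.exists]
  refine exists_congr fun y => ?_
  rw [funext_iff]
  exact forall_congr' fun e => by rw [mulVecLin_apply, mulVec, dotProduct_comm]; rfl

theorem mem_ker_iff_dotProduct_eq_zero [Fintype E] [Fintype m] :
    v ∈ LinearMap.ker A.mulVecLin ↔ ∀ w ∈ LinearMap.range Aᵀ.mulVecLin, v ⬝ᵥ w = 0 := by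
  classical
  rw [LinearMap.mem_ker, mulVecLin_apply]
  constructor
  · rintro hv _ ⟨y, rfl⟩
    rw [mulVecLin_apply, dotProduct_mulVec, vecMul_transpose, hv, zero_dotProduct]
  · intro h
    ext i
    have hi := h _ ⟨Pi.single i 1, rfl⟩
    rwa [mulVecLin_apply, mulVec_single_one, dotProduct_comm] at hi

namespace Represents

variable (hA : Represents A M)
include hA

theorem not_indep_iff [Fintype E] :
    ¬ M.Indep X ↔ ∃ z ∈ LinearMap.ker A.mulVecLin, z ≠ 0 ∧ support z ⊆ X := by
  rw [hA.indep_iff, linearIndepOn_col_iff]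
  push Not
  exact exists_congr fun z => and_congr_right fun _ => and_comm

theorem col_mem_span_of_isBasis {I : Set E} (hI : M.IsBasis I X) {e : E} (he : e ∈ X) :
    A.col e ∈ Submodule.span ℝ (A.col '' I) := by
  by_contra h
  have hins : M.Indep (insert e I) := (hA.indep_iff _).2 (((hA.indep_iff I).1 hI.indep).insert h)
  exact h (Submodule.subset_span ⟨e, hI.mem_of_insert_indep he hins, rfl⟩)

theorem isBase_of_forall_col_mem_span {I : Set E} (hI : M.Indep I)
    (h : ∀ e, A.col e ∈ Submodule.span ℝ (A.col '' I)) : M.IsBase I :=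
  hI.isBase_of_forall_insert fun e he hins =>
    ((linearIndepOn_insert he.2).1 ((hA.indep_iff _).1 hins)).2 (h e)

theorem forall_isBase_inter_nonempty_iff [Fintype m] :
    (∀ B, M.IsBase B → (X ∩ B).Nonempty) ↔
      ∃ w ∈ LinearMap.range Aᵀ.mulVecLin, w ≠ 0 ∧ support w ⊆ X := by
  constructor
  · intro hX
    obtain ⟨I, hI⟩ := M.exists_isBasis Xᶜ (by simp [hA.ground_eq])
    obtain ⟨e, he⟩ : ∃ e, A.col e ∉ Submodule.span ℝ (A.col '' I) := by
      by_contra! hspan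
      obtain ⟨e, heX, heI⟩ := hX I (hA.isBase_of_forall_col_mem_span hI.indep hspan)
      exact hI.subset heI heX
    obtain ⟨φ, hφ, hle⟩ := Submodule.exists_le_ker_of_notMem he
    refine ⟨fun f => φ (A.col f), mem_range_transpose_iff.2 ⟨φ, fun _ => rfl⟩,
      fun h => hφ (congrFun h e), fun f hf => ?_⟩
    by_contra hfX
    exact hf (hle (hA.col_mem_span_of_isBasis hI hfX))
  · rintro ⟨w, hw, hw0, hwX⟩ B hB
    obtain ⟨φ, hφ⟩ := mem_range_transpose_iff.1 hw
    by_contra hXB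
    have hle : Submodule.span ℝ (A.col '' B) ≤ LinearMap.ker φ := by
      rw [Submodule.span_le]
      rintro _ ⟨e, he, rfl⟩
      by_contra hne
      exact hXB ⟨e, hwX fun hwe => hne ((hφ e).trans hwe), he⟩
    refine hw0 (funext fun e => (hφ e).symm.trans (hle ?_))
    exact hA.col_mem_span_of_isBasis hB.isBasis_ground (by simp [hA.ground_eq])

theorem isCircuit_support_iff [Fintype E] (hv : v ∈ LinearMap.ker A.mulVecLin) :
    M.IsCircuit (support v) ↔ IsElementary (LinearMap.ker A.mulVecLin) v := by
  rw [Matroid.isCircuit_iff_minimal_not_indep (by simp [hA.ground_eq]),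
    isElementary_iff_minimal hv]
  simp only [hA.not_indep_iff]

theorem isCocircuit_support_iff [Fintype m] (hv : v ∈ LinearMap.range Aᵀ.mulVecLin) :
    M.IsCocircuit (support v) ↔ IsElementary (LinearMap.range Aᵀ.mulVecLin) v := by
  rw [Matroid.isCocircuit_iff_minimal, isElementary_iff_minimal hv]
  simp only [hA.forall_isBase_inter_nonempty_iff]

end Represents

/-- The signed circuits of the oriented matroid of `S`, as sets of arcs: the `{0, 1, -1}`-valued
elementary vectors of `S`. Specialising `S` to the kernel and to the row space of a representation
treats circuits and cocircuits at once. -/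
def IsElementaryArcSet (S : Submodule ℝ (E → ℝ)) (C : Fourientation E) : Prop :=
  ∃ v, IsElementary S v ∧ IsSignVector v ∧ C = arcsOf v

theorem Represents.isSignedCircuit_iff [Fintype E] (hA : Represents A M) {C : Fourientation E} :
    IsSignedCircuit A M C ↔ IsElementaryArcSet (LinearMap.ker A.mulVecLin) C := by
  refine exists_congr fun v => ⟨fun ⟨hs, hv, hc, hC⟩ => ?_, fun ⟨hv, hs, hC⟩ => ?_⟩
  · exact ⟨(hA.isCircuit_support_iff hv).1 hc, hs, hC⟩
  · exact ⟨hs, hv.mem, (hA.isCircuit_support_iff hv.mem).2 hv, hC⟩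

theorem Represents.isSignedCocircuit_iff [Fintype m] (hA : Represents A M) {C : Fourientation E} :
    IsSignedCocircuit A M C ↔ IsElementaryArcSet (LinearMap.range Aᵀ.mulVecLin) C := by
  refine exists_congr fun v => ⟨fun ⟨hs, hv, hc, hC⟩ => ?_, fun ⟨hv, hs, hC⟩ => ?_⟩
  · exact ⟨(hA.isCocircuit_support_iff hv).1 hc, hs, hC⟩
  · exact ⟨hs, hv.mem, (hA.isCocircuit_support_iff hv.mem).2 hv, hC⟩

end Circuits

section Orientations

variable {v x : E → ℝ} {e : E} {s : ℤˣ}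

theorem mem_reverse {F : Fourientation E} : (e, s) ∈ reverse F ↔ (e, -s) ∈ F := Iff.rfl

theorem reverse_compl (F : Fourientation E) : reverse Fᶜ = (reverse F)ᶜ := rfl

theorem reverse_inter_reverse (F G : Fourientation E) :
    reverse (F ∩ reverse G) = G ∩ reverse F := by
  ext ⟨e, s⟩
  rw [mem_reverse, Set.mem_inter_iff, mem_reverse, neg_neg, Set.mem_inter_iff, mem_reverse,
    and_comm]

theorem mem_arcsOf : (e, s) ∈ arcsOf v ↔ v e = ((s : ℤ) : ℝ) := Iff.rfl

theorem ne_zero_of_mem_arcsOf (h : (e, s) ∈ arcsOf v) : v e ≠ 0 := by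
  rw [mem_arcsOf.1 h]
  exact_mod_cast s.ne_zero

theorem arcsOf_subset_arcsOf (h : ∀ e, v e ≠ 0 → v e = x e) : arcsOf v ⊆ arcsOf x :=
  fun a ha => (h a.1 (ne_zero_of_mem_arcsOf ha)).symm.trans ha

theorem IsSignVector.exists_mem_arcsOf (hv : IsSignVector v) (he : v e ≠ 0) :
    ∃ s, (e, s) ∈ arcsOf v := by
  rcases hv e with h | h | h
  · exact absurd h he
  · exact ⟨1, by simp [mem_arcsOf, h]⟩
  · exact ⟨-1, by simp [mem_arcsOf, h]⟩

theorem IsSignVector.ext_arcsOf (hv : IsSignVector v) (hx : IsSignVector x)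
    (h : arcsOf v = arcsOf x) : v = x := by
  ext e
  by_cases hve : v e = 0
  · by_contra hne
    obtain ⟨s, hs⟩ := hx.exists_mem_arcsOf (e := e) fun hxe => hne (hve.trans hxe.symm)
    exact ne_zero_of_mem_arcsOf (h ▸ hs) hve
  · obtain ⟨s, hs⟩ := hv.exists_mem_arcsOf hve
    exact (mem_arcsOf.1 hs).trans (mem_arcsOf.1 (h ▸ hs)).symm

namespace EdgeOrientation

/-- The indicator vector of the set of edges whose positive arc lies in `O`. The difference of two
such vectors records the arcs on which the orientations disagree, see `arcsOf_ind_sub`. -/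
noncomputable def ind (O : EdgeOrientation E) : E → ℝ :=
  Set.indicator {e | (e, 1) ∈ O.arcs} 1

variable {O O' : EdgeOrientation E}

theorem neg_mem_arcs_iff : (e, -s) ∈ O.arcs ↔ (e, s) ∉ O.arcs := by
  obtain ⟨t, ht, huniq⟩ := O.isOneWay e
  have hiff : ∀ s, (e, s) ∈ O.arcs ↔ s = t := fun s => ⟨huniq s, fun h => h ▸ ht⟩
  rw [hiff, hiff]
  exact ⟨fun h hs => units_ne_neg_self s (hs.trans h.symm),
    fun h => (Int.units_ne_iff_eq_neg.1 (Ne.symm h)).symm⟩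

theorem ind_eq_zero_or_one (O : EdgeOrientation E) (e : E) : O.ind e = 0 ∨ O.ind e = 1 :=
  Set.indicator_eq_zero_or_self _ 1 e

theorem ind_eq_one_iff : O.ind e = 1 ↔ (e, 1) ∈ O.arcs :=
  Set.indicator_eq_one_iff_mem ℝ

theorem isSignVector_ind_sub (O O' : EdgeOrientation E) : IsSignVector (O.ind - O'.ind) := by
  intro e
  rw [Pi.sub_apply]
  rcases O.ind_eq_zero_or_one e with h | h <;> rcases O'.ind_eq_zero_or_one e with h' | h' <;>
    simp [h, h']

theorem ind_eq_zero_iff : O.ind e = 0 ↔ (e, -1) ∈ O.arcs := by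
  rw [neg_mem_arcs_iff, ← ind_eq_one_iff]
  rcases O.ind_eq_zero_or_one e with h | h <;> simp [h]

theorem exists_ind_eq (hx : ∀ e, x e = 0 ∨ x e = 1) : ∃ O : EdgeOrientation E, O.ind = x := by
  refine ⟨⟨{a | a.2 = 1 ↔ x a.1 = 1}, fun e => ?_⟩, funext fun e => ?_⟩
  · rcases hx e with h | h
    · exact ⟨-1, by simp [h], fun s hs =>
        (Int.units_eq_one_or s).resolve_left (by simpa [h] using hs)⟩
    · exact ⟨1, by simp [h], fun s hs => by simpa [h] using hs⟩
  · rcases hx e with h | h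
    · rw [h, ind_eq_zero_iff]
      simp [h]
    · rw [h, ind_eq_one_iff]
      simp [h]

theorem arcsOf_ind_sub : arcsOf (O.ind - O'.ind) = O.arcs ∩ reverse O'.arcs := by
  ext ⟨e, s⟩
  rw [mem_arcsOf, Set.mem_inter_iff, mem_reverse, Pi.sub_apply]
  rcases Int.units_eq_one_or s with rfl | rfl
  · rw [← ind_eq_one_iff, ← ind_eq_zero_iff]
    rcases O.ind_eq_zero_or_one e with h | h <;>
      rcases O'.ind_eq_zero_or_one e with h' | h' <;> norm_num [h, h']
  · rw [neg_neg, ← ind_eq_one_iff, ← ind_eq_zero_iff]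
    rcases O.ind_eq_zero_or_one e with h | h <;>
      rcases O'.ind_eq_zero_or_one e with h' | h' <;> norm_num [h, h']

theorem exists_common_arc (h : O.ind e = O'.ind e) : ∃ s, (e, s) ∈ O.arcs ∧ (e, s) ∈ O'.arcs := by
  obtain ⟨s, hs, -⟩ := O.isOneWay e
  refine ⟨s, hs, by_contra fun hs' => ?_⟩
  have hmem : (e, s) ∈ arcsOf (O.ind - O'.ind) :=
    arcsOf_ind_sub ▸ ⟨hs, neg_mem_arcs_iff.2 hs'⟩
  exact ne_zero_of_mem_arcsOf hmem (sub_eq_zero.2 h)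

theorem ind_injective : Injective (ind : EdgeOrientation E → E → ℝ) := by
  have hle : ∀ {O O' : EdgeOrientation E}, O.ind = O'.ind → O.arcs ⊆ O'.arcs := by
    rintro O O' h ⟨e, s⟩ hs
    obtain ⟨t, ht, ht'⟩ := exists_common_arc (congrFun h e)
    rwa [(O.isOneWay e).unique hs ht]
  intro O O' h
  have harcs : O.arcs = O'.arcs := (hle h).antisymm (hle h.symm)
  cases O
  cases O'
  congr

instance [Finite E] : Finite (EdgeOrientation E) :=
  Finite.of_injective (fun O : EdgeOrientation E => {e | (e, (1 : ℤˣ)) ∈ O.arcs}) fun _ _ h =>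
    ind_injective (congrArg (fun X => Set.indicator X 1) h)

theorem subset_and_arcs_eq_iff {C : Fourientation E} :
    C ⊆ O.arcs ∧ O'.arcs = (O.arcs \ C) ∪ reverse C ↔ C = O.arcs ∩ reverse O'.arcs := by
  constructor
  · rintro ⟨hC, hO'⟩
    ext ⟨e, s⟩
    rw [Set.mem_inter_iff, mem_reverse, hO', Set.mem_union, Set.mem_sdiff, mem_reverse, neg_neg,
      neg_mem_arcs_iff]
    have := @hC (e, s)
    tauto
  · rintro rfl
    refine ⟨Set.inter_subset_left, Set.ext fun ⟨e, s⟩ => ?_⟩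
    rw [Set.mem_union, Set.mem_sdiff, mem_reverse, Set.mem_inter_iff, Set.mem_inter_iff,
      mem_reverse, mem_reverse, neg_neg, neg_mem_arcs_iff, neg_mem_arcs_iff]
    tauto

theorem isElementaryArcSet_inter_reverse_iff {S : Submodule ℝ (E → ℝ)} :
    IsElementaryArcSet S (O.arcs ∩ reverse O'.arcs) ↔ IsElementary S (O.ind - O'.ind) := by
  rw [← arcsOf_ind_sub]
  refine ⟨fun ⟨v, hv, hs, h⟩ => ?_, fun h => ⟨_, h, isSignVector_ind_sub O O', rfl⟩⟩
  rwa [(isSignVector_ind_sub O O').ext_arcsOf hs h]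

end EdgeOrientation

theorem Represents.isReversal_iff [Fintype E] [Fintype m] {A : Matrix m E ℝ} {M : Matroid E}
    (hA : Represents A M) {O O' : EdgeOrientation E} :
    IsReversal A M O O' ↔ IsElementary (LinearMap.ker A.mulVecLin) (O.ind - O'.ind) ∨
      IsElementary (LinearMap.range Aᵀ.mulVecLin) (O.ind - O'.ind) := by
  simp only [IsReversal, hA.isSignedCircuit_iff, hA.isSignedCocircuit_iff,
    EdgeOrientation.subset_and_arcs_eq_iff, exists_eq_right,
    EdgeOrientation.isElementaryArcSet_inter_reverse_iff]

end Orientations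

section ReversalLattice

variable {S : Submodule ℝ (E → ℝ)} {A : Matrix m E ℝ} {u v w x : E → ℝ}

theorem eq_zero_or_eq_zero_of_dotProduct_eq_zero [Fintype E] (h : u ⬝ᵥ w = 0)
    (hle : ∀ e, u e * w e ≤ 0) (e : E) : u e = 0 ∨ w e = 0 :=
  mul_eq_zero.1 ((Finset.sum_eq_zero_iff_of_nonpos fun f _ => hle f).1 h e (Finset.mem_univ e))

/-- The lattice `ℤ^E` inside `ℝ^E`. -/
def integralVectors (E : Type*) : AddSubgroup (E → ℝ) := ((Int.castAddHom ℝ).compLeft E).range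

theorem mem_integralVectors : x ∈ integralVectors E ↔ ∀ e, ∃ n : ℤ, (n : ℝ) = x e := by
  refine ⟨?_, fun h => ?_⟩
  · rintro ⟨z, rfl⟩ e
    exact ⟨z e, rfl⟩
  · choose z hz using h
    exact ⟨z, funext hz⟩

protected theorem IsSignVector.mem_integralVectors (hv : IsSignVector v) :
    v ∈ integralVectors E := by
  refine mem_integralVectors.2 fun e => ?_
  rcases hv e with h | h | h
  · exact ⟨0, by simp [h]⟩
  · exact ⟨1, by simp [h]⟩
  · exact ⟨-1, by simp [h]⟩

theorem EdgeOrientation.ind_mem_integralVectors (O : EdgeOrientation E) :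
    O.ind ∈ integralVectors E := by
  refine mem_integralVectors.2 fun e => ?_
  rcases O.ind_eq_zero_or_one e with h | h
  · exact ⟨0, by simp [h]⟩
  · exact ⟨1, by simp [h]⟩

/-- The lattice generated by the integral vectors in the kernel and in the row space of `A`. Two
orientations lie in the same circuit-cocircuit reversal class if and only if the difference of
their indicator vectors lies in this lattice, see `Represents.eqvGen_isReversal_iff`. -/
def reversalLattice [Fintype E] [Fintype m] (A : Matrix m E ℝ) : AddSubgroup (E → ℝ) :=
  (LinearMap.ker A.mulVecLin).toAddSubgroup ⊓ integralVectors E ⊔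
    (LinearMap.range Aᵀ.mulVecLin).toAddSubgroup ⊓ integralVectors E

theorem IsSignVector.mul_nonpos_of_add (hx : IsSignVector (u + w)) (hu : u ∈ integralVectors E)
    (e : E) : u e * w e ≤ 0 := by
  obtain ⟨n, hn⟩ := mem_integralVectors.1 hu e
  have hle : (n : ℝ) ≤ n ^ 2 := mod_cast Int.le_self_sq n
  have hneg : -(n : ℝ) ≤ n ^ 2 := mod_cast (Int.le_self_sq (-n)).trans_eq (neg_sq n)
  obtain ⟨y, hy⟩ : ∃ y, u e + w e = y := ⟨_, rfl⟩
  rw [← hn] at hy ⊢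
  rw [eq_sub_of_add_eq' hy]
  have hsign := hx e
  rw [Pi.add_apply, ← hn, hy] at hsign
  rcases hsign with rfl | rfl | rfl <;> nlinarith

theorem exists_disjoint_of_mem_reversalLattice [Fintype E] [Fintype m]
    (hx : x ∈ reversalLattice A) (hxs : IsSignVector x) :
    ∃ u ∈ LinearMap.ker A.mulVecLin, ∃ w ∈ LinearMap.range Aᵀ.mulVecLin,
      u + w = x ∧ ∀ e, u e = 0 ∨ w e = 0 := by
  obtain ⟨u, ⟨hu, huℤ⟩, w, ⟨hw, -⟩, rfl⟩ := AddSubgroup.mem_sup.1 hx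
  exact ⟨u, hu, w, hw, rfl, eq_zero_or_eq_zero_of_dotProduct_eq_zero
    (mem_ker_iff_dotProduct_eq_zero.1 hu w hw) (hxs.mul_nonpos_of_add huℤ)⟩

theorem IsRegular.eqvGen_of_ind_sub_mem [Finite E] (hS : IsRegular S)
    {r : EdgeOrientation E → EdgeOrientation E → Prop}
    (hr : ∀ O O', IsElementary S (O.ind - O'.ind) → r O O') {O O' : EdgeOrientation E}
    (h : O.ind - O'.ind ∈ S) : Relation.EqvGen r O O' := by
  induction hn : (support (O.ind - O'.ind)).ncard using Nat.strong_induction_on generalizing O with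
  | _ n ih =>
    by_cases h0 : O.ind - O'.ind = 0
    · rw [EdgeOrientation.ind_injective (sub_eq_zero.1 h0)]
      exact .refl _
    obtain ⟨v, hv, -, hvx⟩ := hS.exists_isElementary h h0 (O.isSignVector_ind_sub O')
    have hstep : ∀ e, O.ind e - v e = O.ind e ∨ O.ind e - v e = O'.ind e := by
      intro e
      by_cases he : v e = 0
      · exact .inl (by rw [he, sub_zero])
      · exact .inr (by rw [hvx e he, Pi.sub_apply, sub_sub_cancel])
    obtain ⟨O₁, hO₁⟩ := EdgeOrientation.exists_ind_eq (x := O.ind - v) fun e => by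
      rw [Pi.sub_apply]
      rcases hstep e with he | he <;> rw [he]
      exacts [O.ind_eq_zero_or_one e, O'.ind_eq_zero_or_one e]
    have hsub : O₁.ind - O'.ind = (O.ind - O'.ind) - v := by rw [hO₁, sub_right_comm]
    have hssub : support (O₁.ind - O'.ind) ⊂ support (O.ind - O'.ind) := by
      obtain ⟨f, hf⟩ := Function.ne_iff.1 hv.ne_zero
      refine (Set.ssubset_iff_of_subset fun e he hxe => ?_).2 ⟨f, ?_, ?_⟩
      · have hve : v e = 0 := by_contra fun hve => hve ((hvx e hve).trans hxe)
        exact he (by rw [hsub, Pi.sub_apply, hxe, hve, sub_zero])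
      · exact fun hxf => hf ((hvx f hf).trans hxf)
      · rw [notMem_support, hsub, Pi.sub_apply, ← hvx f hf, sub_self]
    refine .trans _ O₁ _ (.rel _ _ (hr _ _ ?_)) (ih _ ?_ ?_ rfl)
    · rwa [hO₁, sub_sub_cancel]
    · exact hn ▸ Set.ncard_lt_ncard hssub
    · exact hsub ▸ sub_mem h hv.mem

theorem Represents.ind_sub_mem_reversalLattice [Fintype E] [Fintype m] {M : Matroid E}
    (hA : Represents A M) {O O' : EdgeOrientation E}
    (h : Relation.EqvGen (IsReversal A M) O O') : O.ind - O'.ind ∈ reversalLattice A := by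
  induction h with
  | rel O O' h =>
    have hℤ := (O.isSignVector_ind_sub O').mem_integralVectors
    rcases hA.isReversal_iff.1 h with h | h
    · exact AddSubgroup.mem_sup_left ⟨h.mem, hℤ⟩
    · exact AddSubgroup.mem_sup_right ⟨h.mem, hℤ⟩
  | refl O => rw [sub_self]; exact zero_mem _
  | symm O O' _ h => rw [← neg_sub]; exact neg_mem h
  | trans O₁ O₂ O₃ _ _ h h' => rw [← sub_add_sub_cancel _ O₂.ind]; exact add_mem h h'

theorem Represents.eqvGen_isReversal_iff [Fintype E] [Fintype m] {M : Matroid E}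
    (hA : Represents A M) (hker : IsRegular (LinearMap.ker A.mulVecLin))
    (hrange : IsRegular (LinearMap.range Aᵀ.mulVecLin)) {O O' : EdgeOrientation E} :
    Relation.EqvGen (IsReversal A M) O O' ↔ O.ind - O'.ind ∈ reversalLattice A := by
  refine ⟨hA.ind_sub_mem_reversalLattice, fun h => ?_⟩
  obtain ⟨u, hu, w, hw, huw, hdisj⟩ :=
    exists_disjoint_of_mem_reversalLattice h (O.isSignVector_ind_sub O')
  obtain ⟨O₁, hO₁⟩ := EdgeOrientation.exists_ind_eq (x := O.ind - u) fun e => by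
    rcases hdisj e with he | he
    · simpa [he] using O.ind_eq_zero_or_one e
    · have hue : u e = O.ind e - O'.ind e := by simpa [he] using congrFun huw e
      simpa [hue] using O'.ind_eq_zero_or_one e
  refine .trans _ O₁ _ (hker.eqvGen_of_ind_sub_mem (fun O O' h => hA.isReversal_iff.2 (.inl h)) ?_)
    (hrange.eqvGen_of_ind_sub_mem (fun O O' h => hA.isReversal_iff.2 (.inr h)) ?_)
  · rwa [hO₁, sub_sub_cancel]
  · rwa [hO₁, sub_right_comm, ← huw, add_sub_cancel_left]

end ReversalLattice

section Injectivity

theorem IsRegular.exists_isElementaryArcSet_subset [Fintype E] {S : Submodule ℝ (E → ℝ)}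
    {u w x : E → ℝ} {F G : Fourientation E} (hS : IsRegular S) (hu : u ∈ S)
    (hw : ∀ c ∈ S, c ⬝ᵥ w = 0) (huw : u + w = x) (hdisj : ∀ e, u e = 0 ∨ w e = 0)
    (hx : IsSignVector x) (hF : arcsOf x ⊆ F) (hG : arcsOf x ⊆ G)
    (hcover : ∀ e s, x e = 0 → (e, s) ∈ F ∨ (e, s) ∈ G)
    (hC : ∃ C, IsElementaryArcSet S C ∧ C ⊆ Gᶜ) : ∃ C, IsElementaryArcSet S C ∧ C ⊆ F := by
  have hux : ∀ e, u e ≠ 0 → u e = x e := fun e he => by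
    rw [← huw, Pi.add_apply, (hdisj e).resolve_left he, add_zero]
  by_cases hu0 : u = 0
  · obtain rfl : w = x := by rw [← huw, hu0, zero_add]
    obtain ⟨_, ⟨c, hc, hcs, rfl⟩, hcG⟩ := hC
    have hle : ∀ e, c e * w e ≤ 0 := fun e => by
      by_contra! hpos
      obtain ⟨s, hs⟩ := hcs.exists_mem_arcsOf (left_ne_zero_of_mul hpos.ne')
      have hws : (e, s) ∈ arcsOf w := (hcs.eq_of_mul_pos hx hpos).symm.trans hs
      exact hcG hs (hG hws)
    refine ⟨_, ⟨c, hc, hcs, rfl⟩, fun ⟨e, s⟩ hs => ?_⟩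
    have hwe : w e = 0 :=
      (eq_zero_or_eq_zero_of_dotProduct_eq_zero (hw c hc.mem) hle e).resolve_left
        (ne_zero_of_mem_arcsOf hs)
    exact (hcover e s hwe).resolve_right (hcG hs)
  · have hus : IsSignVector u := fun e => by
      by_cases he : u e = 0
      exacts [.inl he, hux e he ▸ hx e]
    obtain ⟨v, hv, hvs, hvu⟩ := hS.exists_isElementary hu hu0 hus
    refine ⟨_, ⟨v, hv, hvs, rfl⟩, (arcsOf_subset_arcsOf fun e he => ?_).trans hF⟩
    rw [hvu e he]
    exact hux e (hvu e he ▸ he)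

variable {M : Matroid E} {𝒜 : ExternalAtlas M} {𝒜' : InternalAtlas M} {B₁ B₂ : Basis M} {e : E}

theorem mem_orient_or_mem_orient (𝒜 : ExternalAtlas M) (𝒜' : InternalAtlas M) (B : Basis M)
    (e : E) (s : ℤˣ) : (e, s) ∈ 𝒜.orient B ∨ (e, s) ∈ 𝒜'.orient B := by
  by_cases he : e ∈ B.1
  · exact .inl (𝒜.internal B e he s)
  · exact .inr (𝒜'.external B e he s)

theorem mem_inter_reverse_or_mem_inter_reverse
    (h : (orientationOfBasis 𝒜 𝒜' B₁).ind e = (orientationOfBasis 𝒜 𝒜' B₂).ind e) (s : ℤˣ) :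
    (e, s) ∈ 𝒜.orient B₁ ∩ reverse (𝒜.orient B₂) ∨
      (e, s) ∈ 𝒜'.orient B₁ ∩ reverse (𝒜'.orient B₂) := by
  obtain ⟨t, ⟨h₁, h₁'⟩, h₂, h₂'⟩ := EdgeOrientation.exists_common_arc h
  by_cases hst : s = t
  · rw [hst]
    exact (mem_orient_or_mem_orient 𝒜 𝒜' B₂ e (-t)).imp (⟨h₁, ·⟩) (⟨h₁', ·⟩)
  · have hneg : -s = t := by rw [Int.units_ne_iff_eq_neg.1 hst, neg_neg]
    rw [← hneg] at h₂ h₂'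
    exact (mem_orient_or_mem_orient 𝒜 𝒜' B₁ e s).imp (⟨·, h₂⟩) (⟨·, h₂'⟩)

theorem arcsOf_ind_sub_subset_external :
    arcsOf ((orientationOfBasis 𝒜 𝒜' B₁).ind - (orientationOfBasis 𝒜 𝒜' B₂).ind) ⊆
      𝒜.orient B₁ ∩ reverse (𝒜.orient B₂) := by
  rw [EdgeOrientation.arcsOf_ind_sub]
  exact fun _ h => ⟨h.1.1, h.2.1⟩

theorem arcsOf_ind_sub_subset_internal :
    arcsOf ((orientationOfBasis 𝒜 𝒜' B₁).ind - (orientationOfBasis 𝒜 𝒜' B₂).ind) ⊆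
      𝒜'.orient B₁ ∩ reverse (𝒜'.orient B₂) := by
  rw [EdgeOrientation.arcsOf_ind_sub]
  exact fun _ h => ⟨h.1.2, h.2.2⟩

variable [Fintype E] [Fintype m] {A : Matrix m E ℝ}

theorem ExternalAtlas.IsTriangulating.eq_of_ind_sub_mem (htri : 𝒜.IsTriangulating A)
    (hA : Represents A M) (hker : IsRegular (LinearMap.ker A.mulVecLin))
    (hdiss' : 𝒜'.IsDissecting A)
    (h : (orientationOfBasis 𝒜 𝒜' B₁).ind - (orientationOfBasis 𝒜 𝒜' B₂).ind ∈
      reversalLattice A) : B₁ = B₂ := by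
  by_contra hne
  have hxs := (orientationOfBasis 𝒜 𝒜' B₁).isSignVector_ind_sub (orientationOfBasis 𝒜 𝒜' B₂)
  obtain ⟨u, hu, w, hw, huw, hdisj⟩ := exists_disjoint_of_mem_reversalLattice h hxs
  have htri := htri B₁ B₂ hne
  have hdiss' := hdiss' B₁ B₂ hne
  simp only [IsPotentialCircuit, hA.isSignedCircuit_iff] at htri hdiss'
  exact htri (hker.exists_isElementaryArcSet_subset hu
    (fun c hc => mem_ker_iff_dotProduct_eq_zero.1 hc w hw) huw hdisj hxs
    arcsOf_ind_sub_subset_external arcsOf_ind_sub_subset_internal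
    (fun e s he => mem_inter_reverse_or_mem_inter_reverse (sub_eq_zero.1 he) s) hdiss')

theorem InternalAtlas.IsTriangulating.eq_of_ind_sub_mem (htri' : 𝒜'.IsTriangulating A)
    (hA : Represents A M) (hrange : IsRegular (LinearMap.range Aᵀ.mulVecLin))
    (hdiss : 𝒜.IsDissecting A)
    (h : (orientationOfBasis 𝒜 𝒜' B₁).ind - (orientationOfBasis 𝒜 𝒜' B₂).ind ∈
      reversalLattice A) : B₁ = B₂ := by
  by_contra hne
  have hxs := (orientationOfBasis 𝒜 𝒜' B₁).isSignVector_ind_sub (orientationOfBasis 𝒜 𝒜' B₂)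
  obtain ⟨u, hu, w, hw, huw, hdisj⟩ := exists_disjoint_of_mem_reversalLattice h hxs
  have htri' := htri' B₂ B₁ (Ne.symm hne)
  have hdiss := hdiss B₂ B₁ (Ne.symm hne)
  simp only [IsPotentialCocircuit, hA.isSignedCocircuit_iff, reverse_compl,
    reverse_inter_reverse, compl_compl] at htri' hdiss
  exact htri' (hrange.exists_isElementaryArcSet_subset hw
    (fun c hc => (dotProduct_comm c u).trans (mem_ker_iff_dotProduct_eq_zero.1 hu c hc))
    ((add_comm w u).trans huw) (fun e => (hdisj e).symm) hxs
    arcsOf_ind_sub_subset_internal arcsOf_ind_sub_subset_external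
    (fun e s he => (mem_inter_reverse_or_mem_inter_reverse (sub_eq_zero.1 he) s).symm) hdiss)

end Injectivity

section CauchyBinet

variable {κ : Type*} [Fintype κ] [DecidableEq κ]

theorem det_mul_transpose_eq_sum {R : Type*} [CommRing R] [Fintype E] (P Q : Matrix κ E R) :
    (P * Qᵀ).det = ∑ f : κ → E, (∏ i, P i (f i)) * (Q.submatrix id f).det := by
  classical
  have hrows : P * Qᵀ = of fun i => ∑ e, P i e • Qᵀ e := by
    ext i j
    simp [mul_apply]
  rw [hrows]
  refine (detRowAlternating.toMultilinearMap.map_sum fun i e => P i e • Qᵀ e).trans ?_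
  refine Finset.sum_congr rfl fun f _ => ?_
  rw [MultilinearMap.map_smul_univ, smul_eq_mul, ← det_transpose]
  rfl

/-- The Cauchy–Binet formula, with each maximal minor counted once for every ordering of its
columns. -/
theorem factorial_mul_det_mul_transpose {R : Type*} [CommRing R] [Fintype E]
    (P Q : Matrix κ E R) :
    (Fintype.card κ).factorial * (P * Qᵀ).det =
      ∑ f : κ → E, (P.submatrix id f).det * (Q.submatrix id f).det := by
  have hperm (σ : Equiv.Perm κ) : (P * Qᵀ).det =
      ∑ f : κ → E, σ.sign * (∏ i, P i (f (σ i))) * (Q.submatrix id f).det := by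
    rw [det_mul_transpose_eq_sum, ← (Equiv.arrowCongr σ.symm (Equiv.refl E)).sum_comp]
    refine Finset.sum_congr rfl fun f _ => ?_
    have hdet : (Q.submatrix id (f ∘ σ)).det = σ.sign * (Q.submatrix id f).det :=
      det_permute' σ (Q.submatrix id f)
    rw [mul_comm (σ.sign : R), mul_assoc, ← hdet]
    rfl
  have hminor (f : κ → E) :
      (P.submatrix id f).det = ∑ σ : Equiv.Perm κ, σ.sign * ∏ i, P i (f (σ i)) := by
    rw [← det_transpose, det_apply']
    rfl
  rw [← Fintype.card_perm, ← nsmul_eq_mul, ← Finset.card_univ, ← Finset.sum_const]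
  simp only [hminor, Finset.sum_mul]
  rw [Finset.sum_comm]
  exact Finset.sum_congr rfl fun σ _ => hperm σ

end CauchyBinet

section Counting

theorem natCard_equiv_le (α β : Type*) [Fintype α] :
    Nat.card (α ≃ β) ≤ (Fintype.card α).factorial := by
  classical
  rcases isEmpty_or_nonempty (α ≃ β) with _ | ⟨⟨i⟩⟩
  · simp
  · rw [Nat.card_congr ((Equiv.refl α).equivCongr i.symm), Nat.card_eq_fintype_card,
      Fintype.card_perm]

variable {κ : Type*} [Fintype κ] [DecidableEq κ] {M : Matroid E} {N : Matrix κ E ℝ}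

theorem injective_of_det_submatrix_ne_zero {f : κ → E} (hf : (N.submatrix id f).det ≠ 0) :
    Injective f := fun i j hij => by
  by_contra hne
  exact hf (det_zero_of_column_eq hne fun k => by rw [submatrix_apply, submatrix_apply, hij])

theorem Represents.isBase_range_of_det_ne_zero [Finite E] (hN : Represents N M) {f : κ → E}
    (hf : (N.submatrix id f).det ≠ 0) : M.IsBase (Set.range f) := by
  have hli : LinearIndependent ℝ (N.submatrix id f).col :=
    linearIndependent_cols_iff_isUnit.2 ((isUnit_iff_isUnit_det _).2 hf.isUnit)
  have hinj := injective_of_det_submatrix_ne_zero hf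
  have hspan : Submodule.span ℝ (Set.range (N.submatrix id f).col) = ⊤ :=
    hli.span_eq_top_of_card_eq_finrank' (by simp)
  refine hN.isBase_of_forall_col_mem_span ((hN.indep_iff _).2 ?_) fun e => ?_
  · exact (linearIndepOn_range_iff hinj _).2 hli
  · rw [← Set.range_comp]
    exact hspan ▸ Submodule.mem_top

theorem Represents.natCard_det_submatrix_ne_zero_le [Finite E] (hN : Represents N M) :
    Nat.card {f : κ → E // (N.submatrix id f).det ≠ 0} ≤
      (Fintype.card κ).factorial * Nat.card (Basis M) := by
  have := Fintype.ofFinite (Basis M)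
  let toEquiv (f : {f : κ → E // (N.submatrix id f).det ≠ 0}) : Σ B : Basis M, κ ≃ B.1 :=
    ⟨⟨Set.range f.1, hN.isBase_range_of_det_ne_zero f.2⟩,
      Equiv.ofInjective f.1 (injective_of_det_submatrix_ne_zero f.2)⟩
  have hinj : Injective toEquiv := fun f g h =>
    Subtype.ext (congrArg (fun p : Σ B : Basis M, κ ≃ B.1 => fun i => (p.2 i : E)) h)
  calc _ ≤ Nat.card (Σ B : Basis M, κ ≃ B.1) := Nat.card_le_card_of_injective toEquiv hinj
    _ = ∑ B : Basis M, Nat.card (κ ≃ B.1) := Nat.card_sigma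
    _ ≤ Fintype.card (Basis M) • (Fintype.card κ).factorial :=
      Finset.sum_le_card_nsmul _ _ _ fun B _ => natCard_equiv_le κ B.1
    _ = _ := by rw [smul_eq_mul, mul_comm, Nat.card_eq_fintype_card]

theorem Represents.det_mul_transpose_le [Fintype E] (hN : Represents N M)
    (hTU : N.IsTotallyUnimodular) : (N * Nᵀ).det ≤ Nat.card (Basis M) := by
  classical
  have hminor : ∀ f : κ → E, (N.submatrix id f).det * (N.submatrix id f).det ≤
      if (N.submatrix id f).det ≠ 0 then 1 else 0 := fun f => by
    obtain ⟨s, hs⟩ := (isTotallyUnimodular_iff_fintype N).1 hTU κ id f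
    rw [← hs]
    cases s <;> simp
  have hfac : 0 < ((Fintype.card κ).factorial : ℝ) := mod_cast (Fintype.card κ).factorial_pos
  refine le_of_mul_le_mul_left ?_ hfac
  calc _ = ∑ f : κ → E, (N.submatrix id f).det * (N.submatrix id f).det :=
      factorial_mul_det_mul_transpose N N
    _ ≤ ∑ f : κ → E, if (N.submatrix id f).det ≠ 0 then 1 else 0 :=
      Finset.sum_le_sum fun f _ => hminor f
    _ = Nat.card {f : κ → E // (N.submatrix id f).det ≠ 0} := by
      rw [Finset.sum_boole, Nat.card_eq_fintype_card, Fintype.card_subtype]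
    _ ≤ _ := mod_cast hN.natCard_det_submatrix_ne_zero_le

end Counting

section Cokernel

theorem natCard_quotient_range_mulVecLin {κ : Type*} [Fintype κ] [DecidableEq κ]
    {G : Matrix κ κ ℤ} (hG : G.det ≠ 0) :
    Nat.card ((κ → ℤ) ⧸ LinearMap.range G.mulVecLin) = G.det.natAbs := by
  have hinj : Injective G.mulVecLin := mulVec_injective_of_det_ne_zero hG
  rw [← Submodule.natAbs_det_equiv _ (LinearEquiv.ofInjective _ hinj), ← LinearMap.det_toLin']
  rfl

theorem exists_map_intCast_eq {A : Matrix m E ℝ} (hA : A.IsTotallyUnimodular) :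
    ∃ Z : Matrix m E ℤ, Z.map (Int.cast : ℤ → ℝ) = A := by
  choose s hs using fun i e => hA.apply i e
  exact ⟨of fun i e => (s i e : ℤ), by ext i e; simp [← hs]⟩

theorem map_intCast_mulVec [Fintype E] (Z : Matrix m E ℤ) (z : E → ℤ) :
    (Z.map (Int.cast : ℤ → ℝ)) *ᵥ (fun e => (z e : ℝ)) = fun i => ((Z *ᵥ z) i : ℝ) := by
  ext i
  simp [mulVec, dotProduct]

theorem intCast_mem_reversalLattice [Fintype E] [Fintype m] {Z : Matrix m E ℤ} {z : E → ℤ}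
    (hz : Z *ᵥ z ∈ LinearMap.range (Z * Zᵀ).mulVecLin) :
    (fun e => (z e : ℝ)) ∈ reversalLattice (Z.map (Int.cast : ℤ → ℝ)) := by
  obtain ⟨y, hy⟩ := hz
  rw [mulVecLin_apply, ← mulVec_mulVec] at hy
  have hker : Z *ᵥ (z - Zᵀ *ᵥ y) = 0 := by rw [mulVec_sub, hy, sub_self]
  have hadd : (fun e => (z e : ℝ)) =
      (fun e => ((z - Zᵀ *ᵥ y) e : ℝ)) + fun e => ((Zᵀ *ᵥ y) e : ℝ) := by
    ext e
    simp
  rw [hadd]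
  refine AddSubgroup.add_mem_sup ⟨?_, _, rfl⟩ ⟨⟨fun i => (y i : ℝ), ?_⟩, _, rfl⟩
  · change _ ∈ LinearMap.ker _
    rw [LinearMap.mem_ker, mulVecLin_apply, map_intCast_mulVec, hker]
    exact funext fun _ => Int.cast_zero
  · rw [mulVecLin_apply, ← transpose_map, map_intCast_mulVec]

theorem Represents.natCard_reversalClass_le_natAbs_det {κ : Type*} [Fintype κ] [DecidableEq κ]
    [Fintype E] [Fintype m] {M : Matroid E} {A : Matrix m E ℝ} (hA : Represents A M)
    (hTU : A.IsTotallyUnimodular) {Z : Matrix κ E ℤ} (hdet : (Z * Zᵀ).det ≠ 0)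
    (hZ : reversalLattice (Z.map (Int.cast : ℤ → ℝ)) = reversalLattice A) :
    Nat.card (ReversalClass A M) ≤ (Z * Zᵀ).det.natAbs := by
  have hcard := natCard_quotient_range_mulVecLin hdet
  have : Finite ((κ → ℤ) ⧸ LinearMap.range (Z * Zᵀ).mulVecLin) :=
    Nat.finite_of_card_ne_zero (hcard ▸ Int.natAbs_ne_zero.2 hdet)
  have hint (O : EdgeOrientation E) : ∃ z : E → ℤ, (fun e => (z e : ℝ)) = O.ind :=
    O.ind_mem_integralVectors
  choose z hz using hint
  let toCokernel (c : ReversalClass A M) : (κ → ℤ) ⧸ LinearMap.range (Z * Zᵀ).mulVecLin :=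
    Submodule.Quotient.mk (Z *ᵥ z c.out)
  rw [← hcard]
  refine Nat.card_le_card_of_injective toCokernel fun c c' h => ?_
  rw [← c.out_eq, ← c'.out_eq]
  refine Quotient.sound ((hA.eqvGen_isReversal_iff (isRegular_ker hTU)
    (isRegular_range_transpose hTU)).2 ?_)
  have hmem := (Submodule.Quotient.eq _).1 h
  rw [← mulVec_sub] at hmem
  rw [← hZ, ← hz, ← hz]
  convert intCast_mem_reversalLattice hmem using 1
  exact funext fun e => (Int.cast_sub _ _).symm

theorem Represents.of_ker_eq [Fintype E] {κ : Type*} {M : Matroid E} {A : Matrix m E ℝ}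
    {N : Matrix κ E ℝ} (hA : Represents A M)
    (h : LinearMap.ker N.mulVecLin = LinearMap.ker A.mulVecLin) : Represents N M :=
  ⟨hA.ground_eq, fun I => by rw [hA.indep_iff, linearIndepOn_col_iff, linearIndepOn_col_iff, h]⟩

theorem Represents.natCard_reversalClass_le [Fintype E] [Fintype m] {M : Matroid E}
    {A : Matrix m E ℝ} (hA : Represents A M) (hTU : A.IsTotallyUnimodular) :
    Nat.card (ReversalClass A M) ≤ Nat.card (Basis M) := by
  classical
  obtain ⟨κ, a, ha, hspan, hli⟩ := exists_linearIndependent' ℝ A.row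
  have := Fintype.ofInjective a ha
  obtain ⟨N, hN⟩ : ∃ N, N = A.submatrix a id := ⟨_, rfl⟩
  have hrange : LinearMap.range Nᵀ.mulVecLin = LinearMap.range Aᵀ.mulVecLin := by
    rw [hN, range_mulVecLin, range_mulVecLin]
    exact hspan
  have hker : LinearMap.ker N.mulVecLin = LinearMap.ker A.mulVecLin := by
    ext v
    rw [mem_ker_iff_dotProduct_eq_zero, mem_ker_iff_dotProduct_eq_zero, hrange]
  have hNTU : N.IsTotallyUnimodular := hN ▸ hTU.submatrix a id
  have hpos : 0 < (N * Nᵀ).det := by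
    simpa using (PosDef.mul_conjTranspose_self N (vecMul_injective_iff.2 (hN ▸ hli))).det_pos
  obtain ⟨Z, rfl⟩ := exists_map_intCast_eq hNTU
  have hdet : ((Z * Zᵀ).det : ℝ) =
      (Z.map (Int.cast : ℤ → ℝ) * (Z.map (Int.cast : ℤ → ℝ))ᵀ).det := by
    rw [Int.cast_det, ← transpose_map]
    exact congrArg det (Matrix.map_mul (f := Int.castRingHom ℝ))
  rw [← hdet] at hpos
  have hposℤ : 0 < (Z * Zᵀ).det := mod_cast hpos
  have hle : ((Z * Zᵀ).det : ℝ) ≤ Nat.card (Basis M) :=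
    hdet ▸ (hA.of_ker_eq hker).det_mul_transpose_le hNTU
  refine (hA.natCard_reversalClass_le_natAbs_det hTU hposℤ.ne' ?_).trans ?_
  · rw [reversalLattice, reversalLattice, hker, hrange]
  · have : (Z * Zᵀ).det ≤ Nat.card (Basis M) := mod_cast hle
    omega

end Cokernel

end RegularMatroid

theorem theorem1p5 {E m : Type*} [Fintype E] [Fintype m] (M : Matroid E) (A : Matrix m E ℝ)
    (hTU : A.IsTotallyUnimodular) (hA : RegularMatroid.Represents A M)
    (𝒜 : RegularMatroid.ExternalAtlas M) (𝒜' : RegularMatroid.InternalAtlas M)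
    (hdiss : 𝒜.IsDissecting A) (hdiss' : 𝒜'.IsDissecting A)
    (htri : 𝒜.IsTriangulating A ∨ 𝒜'.IsTriangulating A) :
    Function.Bijective (fun B : RegularMatroid.Basis M =>
      (Quotient.mk (RegularMatroid.reversalSetoid A M)
        (RegularMatroid.orientationOfBasis 𝒜 𝒜' B) : RegularMatroid.ReversalClass A M)) := by
  have hker := RegularMatroid.isRegular_ker hTU
  have hrange := RegularMatroid.isRegular_range_transpose hTU
  refine Function.Injective.bijective_of_nat_card_le (fun B₁ B₂ h => ?_)
    (hA.natCard_reversalClass_le hTU)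
  have hmem := (hA.eqvGen_isReversal_iff hker hrange).1 (Quotient.exact h)
  rcases htri with htri | htri'
  · exact htri.eq_of_ind_sub_mem hA hker hdiss' hmem
  · exact htri'.eq_of_ind_sub_mem hA hrange hdiss hmem
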